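/- Let $n\in\mathbb N$ and let $\mathcal F,\mathcal E$ be complex Hilbert spaces. For a Hilbert space $\mathcal H$ let $H^2_{\mathcal H}(\mathbb D^n)$ be the Hardy space of all power series $f(z)=\sum_{k\in\mathbb N^n}a_kz^k$ on the unit polydisc $\mathbb D^n$ with $a_k\in\mathcal H$ and $\|f\|^2=\sum_k\|a_k\|^2<\infty$; it is identified, through boundary values, with the closed subspace of $L^2_{\mathcal H}(\mathbb T^n)$ (normalized Lebesgue measure on the torus) of the functions $\sum_{k\in\mathbb N^n}a_ke^{i\langle k,\theta\rangle}$. A bounded operator $T$ on $H^2_{\mathcal E}(\mathbb D^n)$ is called a Toeplitz operator if there is $\Phi\in L^\infty_{\mathcal B(\mathcal E)}(\mathbb T^n)$ (an essentially bounded function $\mathbb T^n\to\mathcal B(\mathcal E)$ such that $\Phi(\cdot)x$ is strongly measurable for every $x\in\mathcal E$) with $T=P\,L_\Phi|_{H^2_{\mathcal E}(\mathbb D^n)}$, where $L_\Phi$ is multiplication by $\Phi$ on $L^2_{\mathcal E}(\mathbb T^n)$ and $P$ is the orthogonal projection onto the Hardy space. Let $\Gamma,\Psi$ be bounded holomorphic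 functions on $\mathbb D^n$ with values in $\mathcal B(\mathcal F,\mathcal E)$, with Taylor expansions $$\Gamma(z)=\sum_{l\in\mathbb N^n}A_lz^l,\qquad \Psi(z)=\sum_{m\in\mathbb N^n}B_mz^m\qquad(z\in\mathbb D^n),$$ where $A_l,B_m\in\mathcal B(\mathcal F,\mathcal E)$, and let $M_\Gamma,M_\Psi:H^2_{\mathcal F}(\mathbb D^n)\to H^2_{\mathcal E}(\mathbb D^n)$ be the operators of multiplication by $\Gamma$ and $\Psi$. Then $M_\Gamma M_\Psi^*$ is a Toeplitz operator on $H^2_{\mathcal E}(\mathbb D^n)$ if and only if $$A_{l+e_i}\,B_{m+e_i}^*=0\qquad\text{for all } l,m\in\mathbb N^n \text{ and all } i\in\{1,\dots,n\},$$ where $e_i\in\mathbb N^n$ is the $i$-th standard unit vector. -/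

import Mathlib

open MeasureTheory InnerProductSpace
open scoped ENNReal

noncomputable section

namespace PolydiscHardy

variable {n : ℕ} {E F : Type*}
  [NormedAddCommGroup E] [InnerProductSpace ℂ E]
  [NormedAddCommGroup F] [InnerProductSpace ℂ F]

/-- The open unit polydisc `𝔻ⁿ`. -/
def polydisc (n : ℕ) : Set (Fin n → ℂ) := {z | ∀ i, ‖z i‖ < 1}

/-- The monomial `z ^ k = z₁ ^ k₁ ⋯ zₙ ^ kₙ`. -/
def monom (z : Fin n → ℂ) (k : Fin n → ℕ) : ℂ := ∏ i, z i ^ k i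

/-- `Γ ∈ H^∞_{B(F, E)}(𝔻ⁿ)`: holomorphic and bounded on the polydisc (the values of `Γ` outside
the polydisc are irrelevant). -/
structure IsHInfty (Γ : (Fin n → ℂ) → F →L[ℂ] E) : Prop where
  differentiableOn : DifferentiableOn ℂ Γ (polydisc n)
  bounded : ∃ C : ℝ, ∀ z ∈ polydisc n, ‖Γ z‖ ≤ C

/-- The Taylor expansion `Γ(z) = ∑ A_l z ^ l` on the polydisc. -/
def HasTaylorCoeffs (Γ : (Fin n → ℂ) → F →L[ℂ] E) (A : (Fin n → ℕ) → F →L[ℂ] E) : Prop :=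
  ∀ z ∈ polydisc n, HasSum (fun l => monom z l • A l) (Γ z)

/-- The Hardy space `H²_E(𝔻ⁿ)`: the power series `∑ a_k z ^ k` with `∑ ‖a_k‖² < ∞`. An element is
stored as its family of coefficients; the function on the polydisc is `HardySpace.eval`,
which determines the element (`HardySpace.eval_injective`). -/
abbrev HardySpace (n : ℕ) (E : Type*) [NormedAddCommGroup E] [InnerProductSpace ℂ E] : Type _ :=
  lp (fun _ : Fin n → ℕ => E) 2

/-- The value at `z ∈ 𝔻ⁿ` of an element of the Hardy space. -/
def HardySpace.eval (f : HardySpace n E) (z : Fin n → ℂ) : E := ∑' k, monom z k • f k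

/-- `M` is the operator of multiplication by `Γ`: `(M f)(z) = Γ(z) f(z)` on the polydisc. -/
def IsMulOp (Γ : (Fin n → ℂ) → F →L[ℂ] E) (M : HardySpace n F →L[ℂ] HardySpace n E) : Prop :=
  ∀ f : HardySpace n F, ∀ z ∈ polydisc n, (M f).eval z = Γ z (f.eval z)

open Classical in
/-- The analytic Toeplitz operator `M_Γ : H²_F(𝔻ⁿ) → H²_E(𝔻ⁿ)`, the operator of multiplication
by `Γ`. It exists for every bounded `Γ` with a Taylor expansion (`isMulOp_mulOp`), and it is unique
(`IsMulOp.unique`). -/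
def mulOp (Γ : (Fin n → ℂ) → F →L[ℂ] E) : HardySpace n F →L[ℂ] HardySpace n E :=
  if h : ∃ M : HardySpace n F →L[ℂ] HardySpace n E, IsMulOp Γ M then h.choose else 0

/-- Normalized Lebesgue measure on the torus `𝕋ⁿ`. The torus is parametrized by
`(ℝ / ℤ)ⁿ` through `t ↦ (exp (2 π i t₁), …, exp (2 π i tₙ))`. -/
def torusMeasure (n : ℕ) : Measure (UnitAddTorus (Fin n)) :=
  Measure.pi fun _ => AddCircle.haarAddCircle

instance : IsProbabilityMeasure (torusMeasure n) := by
  unfold torusMeasure; infer_instance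

/-- The space `L²_E(𝕋ⁿ)`. -/
abbrev L2Torus (n : ℕ) (E : Type*) [NormedAddCommGroup E] [InnerProductSpace ℂ E] : Type _ :=
  Lp E 2 (torusMeasure n)

/-- The continuous function `t ↦ exp (2 π i ⟨k, t⟩) x` on the torus. -/
def trigMonomial (k : Fin n → ℕ) : E →ₗ[ℂ] C(UnitAddTorus (Fin n), E) where
  toFun x := ⟨fun t => UnitAddTorus.mFourier (fun i => (k i : ℤ)) t • x, by fun_prop⟩
  map_add' x y := by ext t; simp
  map_smul' c x := by ext t; simp [smul_comm c]

theorem mFourier_inner (k l : Fin n → ℕ) (x y : E) :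
    inner ℂ (ContinuousMap.toLp (E := E) 2 (torusMeasure n) ℂ (trigMonomial k x))
      (ContinuousMap.toLp (E := E) 2 (torusMeasure n) ℂ (trigMonomial l y)) =
    if k = l then inner ℂ x y else 0 := by
  have h := orthonormal_iff_ite.mp (UnitAddTorus.orthonormal_mFourier (d := Fin n))
    (fun i => (k i : ℤ)) (fun i => (l i : ℤ))
  rw [ContinuousMap.inner_toLp] at h
  change ∫ t, _ ∂(torusMeasure n) = _ at h
  rw [L2.inner_def]
  have h2 : ∀ᵐ t ∂(torusMeasure n),
      inner ℂ (ContinuousMap.toLp (E := E) 2 (torusMeasure n) ℂ (trigMonomial k x) t)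
        (ContinuousMap.toLp (E := E) 2 (torusMeasure n) ℂ (trigMonomial l y) t) =
      (UnitAddTorus.mFourier (fun i => (l i : ℤ)) t *
        (starRingEnd ℂ) (UnitAddTorus.mFourier (fun i => (k i : ℤ)) t)) * inner ℂ x y := by
    filter_upwards [ContinuousMap.coeFn_toLp (p := 2) (𝕜 := ℂ) (torusMeasure n)
      (trigMonomial k x), ContinuousMap.coeFn_toLp (p := 2) (𝕜 := ℂ) (torusMeasure n)
      (trigMonomial l y)] with t h1 h2
    rw [h1, h2]
    simp only [trigMonomial, LinearMap.coe_mk, AddHom.coe_mk, ContinuousMap.coe_mk,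
      inner_smul_left, inner_smul_right]
    ring
  rw [integral_congr_ae h2, integral_mul_const]
  have h3 : ((fun i => (k i : ℤ)) = fun i => (l i : ℤ)) ↔ k = l := by
    simp [funext_iff]
  rw [h]
  simp [h3]

/-- The isometric embedding `x ↦ exp (2 π i ⟨k, t⟩) x` of `E` into `L²_E(𝕋ⁿ)`. -/
def trigMonomialLp (k : Fin n → ℕ) : E →ₗᵢ[ℂ] L2Torus n E where
  toLinearMap := (ContinuousMap.toLp (E := E) 2 (torusMeasure n) ℂ).toLinearMap ∘ₗ trigMonomial k
  norm_map' x := by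
    have h := mFourier_inner k k x x
    rw [if_pos rfl, inner_self_eq_norm_sq_to_K, inner_self_eq_norm_sq_to_K] at h
    have h' := (sq_eq_sq₀ (norm_nonneg _) (norm_nonneg _)).mp (by exact_mod_cast h)
    exact h'

theorem orthogonalFamily_trigMonomialLp :
    OrthogonalFamily ℂ (fun _ : Fin n → ℕ => E) (trigMonomialLp (n := n) (E := E)) := by
  intro k l hkl x y
  exact (mFourier_inner k l x y).trans (if_neg hkl)

/-- The identification of `H²_E(𝔻ⁿ)` with the Hardy space of the torus, as an isometric
embedding into `L²_E(𝕋ⁿ)`: it sends `∑ a_k z ^ k` to its boundary function, the `L²`-convergent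
series `∑ exp (2 π i ⟨k, t⟩) a_k`. -/
def boundary (n : ℕ) (E : Type*) [NormedAddCommGroup E] [InnerProductSpace ℂ E]
    [CompleteSpace E] : HardySpace n E →ₗᵢ[ℂ] L2Torus n E :=
  orthogonalFamily_trigMonomialLp.linearIsometry

/-- `Φ ∈ L^∞_{B(E)}(𝕋ⁿ)`: an essentially bounded operator-valued function that is strongly
measurable, that is, `t ↦ Φ(t) x` is measurable for every vector `x`. -/
structure IsLInfty (Φ : UnitAddTorus (Fin n) → E →L[ℂ] E) : Prop where
  measurable : ∀ x : E, AEStronglyMeasurable (fun t => Φ t x) (torusMeasure n)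
  bounded : ∃ C : ℝ, ∀ᵐ t ∂(torusMeasure n), ‖Φ t‖ ≤ C

theorem IsLInfty.aestronglyMeasurable_apply {Φ : UnitAddTorus (Fin n) → E →L[ℂ] E}
    (hΦ : IsLInfty Φ) {f : UnitAddTorus (Fin n) → E}
    (hf : AEStronglyMeasurable f (torusMeasure n)) :
    AEStronglyMeasurable (fun t => Φ t (f t)) (torusMeasure n) := by
  obtain ⟨g, hg, hfg⟩ := hf
  refine AEStronglyMeasurable.congr (f := fun t => Φ t (g t)) ?_
    (by filter_upwards [hfg] with t ht; rw [ht])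
  refine aestronglyMeasurable_of_tendsto_ae Filter.atTop (f := fun m t => Φ t (hg.approx m t))
    (fun m => ?_) (Filter.Eventually.of_forall fun t =>
      ((Φ t).continuous.tendsto _).comp (hg.tendsto_approx t))
  have h : (fun t => Φ t (hg.approx m t)) = fun t => ∑ y ∈ (hg.approx m).range,
      ((hg.approx m) ⁻¹' {y}).indicator (fun t => Φ t y) t := by
    funext t
    rw [Finset.sum_eq_single (hg.approx m t)]
    · simp
    · intro y _ hy
      exact Set.indicator_of_notMem (fun h => hy h.symm) _
    · intro h
      exact absurd (SimpleFunc.mem_range_self _ t) h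
  rw [h]
  exact Finset.aestronglyMeasurable_fun_sum _ fun y _ =>
    (hΦ.measurable y).indicator ((hg.approx m).measurableSet_fiber y)

theorem IsLInfty.memLp {Φ : UnitAddTorus (Fin n) → E →L[ℂ] E} (hΦ : IsLInfty Φ)
    (f : L2Torus n E) : MemLp (fun t => Φ t (f t)) 2 (torusMeasure n) := by
  obtain ⟨C, hC⟩ := hΦ.bounded
  refine MemLp.of_le_mul (c := C) (Lp.memLp f)
    (hΦ.aestronglyMeasurable_apply (Lp.aestronglyMeasurable f)) ?_
  filter_upwards [hC] with t ht
  exact (Φ t).le_of_opNorm_le ht _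

/-- The Laurent operator `L_Φ` on `L²_E(𝕋ⁿ)`: pointwise multiplication by `Φ`. -/
def laurent (Φ : UnitAddTorus (Fin n) → E →L[ℂ] E) (hΦ : IsLInfty Φ) :
    L2Torus n E →L[ℂ] L2Torus n E :=
  LinearMap.mkContinuousOfExistsBound
    { toFun := fun f => (hΦ.memLp f).toLp _
      map_add' := fun f g => by
        rw [← MemLp.toLp_add]
        refine MemLp.toLp_congr _ _ ?_
        filter_upwards [Lp.coeFn_add f g] with t ht
        rw [ht, Pi.add_apply, map_add, Pi.add_apply]
      map_smul' := fun c f => by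
        rw [RingHom.id_apply, ← MemLp.toLp_const_smul]
        refine MemLp.toLp_congr _ _ ?_
        filter_upwards [Lp.coeFn_smul c f] with t ht
        rw [ht, Pi.smul_apply, map_smul, Pi.smul_apply] }
    (by
      obtain ⟨C, hC⟩ := hΦ.bounded
      refine ⟨C, fun f => Lp.norm_le_mul_norm_of_ae_le_mul ?_⟩
      filter_upwards [hC, (hΦ.memLp f).coeFn_toLp] with t ht h2
      rw [LinearMap.coe_mk, AddHom.coe_mk, h2]
      exact (Φ t).le_of_opNorm_le ht _)

theorem coeFn_laurent (Φ : UnitAddTorus (Fin n) → E →L[ℂ] E) (hΦ : IsLInfty Φ)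
    (f : L2Torus n E) : laurent Φ hΦ f =ᵐ[torusMeasure n] fun t => Φ t (f t) :=
  (hΦ.memLp f).coeFn_toLp

/-- `T` is a Toeplitz operator on `H²_E(𝔻ⁿ)`: it is the compression `P L_Φ|` of a Laurent operator
with symbol `Φ ∈ L^∞_{B(E)}(𝕋ⁿ)`. As `boundary` is an isometric embedding, its adjoint is the
orthogonal projection `P` of `L²_E(𝕋ⁿ)` onto the Hardy space, followed by the identification of the
Hardy space of the torus with that of the polydisc. -/
def IsToeplitz [CompleteSpace E] (T : HardySpace n E →L[ℂ] HardySpace n E) : Prop :=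
  ∃ (Φ : UnitAddTorus (Fin n) → E →L[ℂ] E) (hΦ : IsLInfty Φ),
    T = (ContinuousLinearMap.adjoint (boundary n E).toContinuousLinearMap) ∘L laurent Φ hΦ ∘L
      (boundary n E).toContinuousLinearMap

/-! The rest shows that `mulOp` is well defined. -/

theorem summable_norm_monom {z : Fin n → ℂ} (hz : z ∈ polydisc n) :
    Summable fun k => ‖monom z k‖ := by
  refine summable_of_sum_le (c := ∏ i, (1 - ‖z i‖)⁻¹) (fun k => norm_nonneg _) fun s => ?_
  obtain ⟨N, hN⟩ : ∃ N : ℕ, ∀ k ∈ s, ∀ i, k i < N := by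
    refine ⟨(∑ k ∈ s, ∑ i, k i) + 1, fun k hk i => Nat.lt_succ_of_le ?_⟩
    exact (Finset.single_le_sum (f := k) (fun _ _ => Nat.zero_le _) (Finset.mem_univ i)).trans
      (Finset.single_le_sum (f := fun k : Fin n → ℕ => ∑ i, k i) (fun _ _ => Nat.zero_le _) hk)
  calc ∑ k ∈ s, ‖monom z k‖
      ≤ ∑ k ∈ Fintype.piFinset fun _ : Fin n => Finset.range N, ‖monom z k‖ :=
        Finset.sum_le_sum_of_subset_of_nonneg
          (fun k hk => Fintype.mem_piFinset.mpr fun i => Finset.mem_range.mpr (hN k hk i))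
          fun _ _ _ => norm_nonneg _
    _ = ∏ i, ∑ j ∈ Finset.range N, ‖z i‖ ^ j := by
        rw [Finset.prod_univ_sum]
        exact Finset.sum_congr rfl fun k _ => by simp [monom, norm_prod]
    _ ≤ ∏ i, (1 - ‖z i‖)⁻¹ := by
        refine Finset.prod_le_prod (fun i _ => Finset.sum_nonneg fun j _ => by positivity)
          fun i _ => ?_
        rw [← tsum_geometric_of_lt_one (norm_nonneg _) (hz i)]
        exact (summable_geometric_of_lt_one (norm_nonneg _) (hz i)).sum_le_tsum _
          fun _ _ => by positivity

theorem monom_add (z : Fin n → ℂ) (k l : Fin n → ℕ) :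
    monom z (k + l) = monom z k * monom z l := by
  simp [monom, pow_add, Finset.prod_mul_distrib]

theorem summable_norm_eval (f : HardySpace n E) {z : Fin n → ℂ} (hz : z ∈ polydisc n) :
    Summable fun k => ‖monom z k • f k‖ := by
  refine Summable.of_nonneg_of_le (fun _ => norm_nonneg _) (fun k => ?_)
    ((summable_norm_monom hz).mul_right ‖f‖)
  rw [norm_smul]
  exact mul_le_mul_of_nonneg_left (lp.norm_apply_le_norm (by norm_num) f k) (norm_nonneg _)

theorem HasTaylorCoeffs.summable_norm {Γ : (Fin n → ℂ) → F →L[ℂ] E}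
    {A : (Fin n → ℕ) → F →L[ℂ] E} (hA : HasTaylorCoeffs Γ A) {z : Fin n → ℂ}
    (hz : z ∈ polydisc n) : Summable fun k => ‖monom z k • A k‖ := by
  have hz1 : ‖z‖ < 1 := (pi_norm_lt_iff one_pos).mpr hz
  obtain ⟨s, hs, hs1⟩ := exists_between hz1
  have hs0 : 0 < s := (norm_nonneg z).trans_lt hs
  have hw : (fun _ : Fin n => (s : ℂ)) ∈ polydisc n := fun i => by
    rw [Complex.norm_real, Real.norm_of_nonneg hs0.le]; exact hs1
  obtain ⟨K, hK⟩ : ∃ K, ∀ k, ‖monom (fun _ : Fin n => (s : ℂ)) k • A k‖ ≤ K := by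
    have h := (hA _ hw).summable.tendsto_cofinite_zero.norm
    obtain ⟨K, hK⟩ := (h.bddAbove_range_of_cofinite)
    exact ⟨K, fun k => hK ⟨k, rfl⟩⟩
  have hq : (fun i => z i / s) ∈ polydisc n := fun i => by
    rw [norm_div, Complex.norm_real, Real.norm_of_nonneg hs0.le, div_lt_one hs0]
    exact (norm_le_pi_norm z i).trans_lt hs
  refine Summable.of_nonneg_of_le (fun _ => norm_nonneg _) (fun k => ?_)
    ((summable_norm_monom hq).mul_right K)
  have : monom z k = monom (fun i => z i / s) k * monom (fun _ : Fin n => (s : ℂ)) k := by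
    rw [monom, monom, monom, ← Finset.prod_mul_distrib]
    refine Finset.prod_congr rfl fun i _ => ?_
    rw [← mul_pow, div_mul_cancel₀ _ (by exact_mod_cast hs0.ne')]
  rw [this, mul_smul, norm_smul]
  exact mul_le_mul_of_nonneg_left (hK k) (norm_nonneg _)

theorem memlp_of_summable_norm {a : (Fin n → ℕ) → E} (ha : Summable fun k => ‖a k‖) :
    Memℓp a 2 := by
  have h : Memℓp a 1 := memℓp_gen (by simpa using ha)
  exact h.of_exponent_ge (by norm_num)

theorem boundary_ae_eq [CompleteSpace E] (b : HardySpace n E) (hb : Summable fun k => ‖b k‖) :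
    boundary n E b =ᵐ[torusMeasure n]
      fun t => ∑' k, UnitAddTorus.mFourier (fun i => ((k i : ℕ) : ℤ)) t • b k := by
  have hs : Summable fun k => trigMonomial k (b k) := by
    refine Summable.of_norm_bounded hb fun k => ?_
    refine (ContinuousMap.norm_le _ (norm_nonneg _)).mpr fun t => ?_
    simp only [trigMonomial, LinearMap.coe_mk, AddHom.coe_mk, ContinuousMap.coe_mk, norm_smul]
    refine mul_le_of_le_one_left (norm_nonneg _) ?_
    exact (ContinuousMap.norm_coe_le_norm _ t).trans UnitAddTorus.mFourier_norm.le
  have h1 := hs.hasSum.mapL (ContinuousMap.toLp (E := E) 2 (torusMeasure n) ℂ)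
  have h2 := orthogonalFamily_trigMonomialLp.hasSum_linearIsometry b
  have h3 : boundary n E b = ContinuousMap.toLp (E := E) 2 (torusMeasure n) ℂ
    (∑' k, trigMonomial k (b k)) := h2.unique h1
  rw [h3]
  filter_upwards [ContinuousMap.coeFn_toLp (p := 2) (𝕜 := ℂ) (torusMeasure n)
    (∑' k, trigMonomial k (b k))] with t ht
  rw [ht]
  exact (ContinuousMap.tsum_apply hs t).symm

/-- The point `(r exp (2 π i t₁), …, r exp (2 π i tₙ))`. -/
def circlePt (r : ℝ) (t : UnitAddTorus (Fin n)) : Fin n → ℂ := fun i => r * fourier 1 (t i)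

theorem circlePt_mem {r : ℝ} (h0 : 0 ≤ r) (h1 : r < 1) (t : UnitAddTorus (Fin n)) :
    circlePt r t ∈ polydisc n := fun i => by
  rw [circlePt, norm_mul, fourier_apply, Circle.norm_coe, mul_one, Complex.norm_real,
    Real.norm_of_nonneg h0]
  exact h1

theorem monom_circlePt (r : ℝ) (t : UnitAddTorus (Fin n)) (k : Fin n → ℕ) :
    monom (circlePt r t) k = UnitAddTorus.mFourier (fun i => ((k i : ℕ) : ℤ)) t *
      monom (fun _ => (r : ℂ)) k := by
  simp only [monom, circlePt, UnitAddTorus.mFourier, ContinuousMap.coe_mk,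
    ← Finset.prod_mul_distrib]
  refine Finset.prod_congr rfl fun i _ => ?_
  rw [mul_pow, mul_comm]
  congr 1
  simp [fourier_apply, AddCircle.toCircle_nsmul]

theorem const_mem {r : ℝ} (h0 : 0 ≤ r) (h1 : r < 1) : (fun _ : Fin n => (r : ℂ)) ∈ polydisc n :=
  fun _ => by simpa [abs_of_nonneg h0] using h1

/-- If two power series satisfy `‖c(z)‖ ≤ C ‖a(z)‖` on the polydisc, then their dilations satisfy
the corresponding inequality between `ℓ²` norms of coefficients. -/
theorem sum_dilate_le [CompleteSpace E] [CompleteSpace F] {c : (Fin n → ℕ) → E}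
    (hc : ∀ z ∈ polydisc n, Summable fun k => ‖monom z k • c k‖) (f : HardySpace n F) {C : ℝ}
    (hC0 : 0 ≤ C) (hC : ∀ z ∈ polydisc n, ‖∑' k, monom z k • c k‖ ≤ C * ‖f.eval z‖)
    (s : Finset (Fin n → ℕ)) {r : ℝ} (h0 : 0 ≤ r) (h1 : r < 1) :
    ∑ k ∈ s, ‖monom (fun _ => (r : ℂ)) k • c k‖ ^ 2 ≤ (C * ‖f‖) ^ 2 := by
  have hr := const_mem (n := n) h0 h1
  let b : HardySpace n E := ⟨_, memlp_of_summable_norm (hc _ hr)⟩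
  let a : HardySpace n F := ⟨_, memlp_of_summable_norm (summable_norm_eval f hr)⟩
  have hab : ‖boundary n E b‖ ≤ C * ‖boundary n F a‖ := by
    refine Lp.norm_le_mul_norm_of_ae_le_mul ?_
    filter_upwards [boundary_ae_eq b (hc _ hr), boundary_ae_eq a (summable_norm_eval f hr)]
      with t hb ha
    rw [hb, ha]
    have h := hC _ (circlePt_mem h0 h1 t)
    simp only [HardySpace.eval, monom_circlePt, mul_smul] at h
    exact h
  rw [LinearIsometry.norm_map, LinearIsometry.norm_map] at hab
  have haf : ‖a‖ ≤ ‖f‖ := by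
    refine lp.norm_le_of_forall_sum_le (by norm_num) (norm_nonneg _) fun s => ?_
    refine le_trans (Finset.sum_le_sum fun k _ => ?_)
      (lp.sum_rpow_le_norm_rpow (p := 2) (by norm_num) f s)
    refine Real.rpow_le_rpow (norm_nonneg _) ?_ (by norm_num)
    change ‖monom (fun _ => (r : ℂ)) k • f k‖ ≤ _
    rw [norm_smul]
    refine mul_le_of_le_one_left (norm_nonneg _) ?_
    simp only [monom, norm_prod, norm_pow, Complex.norm_real, Real.norm_of_nonneg h0]
    exact Finset.prod_le_one (fun _ _ => by positivity) fun _ _ => pow_le_one₀ h0 h1.le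
  have hb := lp.sum_rpow_le_norm_rpow (p := 2) (by norm_num) b s
  simp only [ENNReal.toReal_ofNat, Real.rpow_ofNat] at hb
  refine hb.trans (pow_le_pow_left₀ (norm_nonneg _) (hab.trans ?_) 2)
  exact mul_le_mul_of_nonneg_left haf hC0

theorem sum_le [CompleteSpace E] [CompleteSpace F] {c : (Fin n → ℕ) → E}
    (hc : ∀ z ∈ polydisc n, Summable fun k => ‖monom z k • c k‖) (f : HardySpace n F) {C : ℝ}
    (hC0 : 0 ≤ C) (hC : ∀ z ∈ polydisc n, ‖∑' k, monom z k • c k‖ ≤ C * ‖f.eval z‖)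
    (s : Finset (Fin n → ℕ)) : ∑ k ∈ s, ‖c k‖ ^ 2 ≤ (C * ‖f‖) ^ 2 := by
  have hcont : Continuous fun r : ℝ => ∑ k ∈ s, ‖monom (fun _ => (r : ℂ)) k • c k‖ ^ 2 := by
    unfold monom; fun_prop
  have ht := (hcont.tendsto 1).mono_left (nhdsWithin_le_nhds (s := Set.Iio 1))
  have := le_of_tendsto ht (b := (C * ‖f‖) ^ 2) (by
    filter_upwards [Ioo_mem_nhdsLT (zero_lt_one (α := ℝ))] with r hr
    exact sum_dilate_le hc f hC0 hC s hr.1.le hr.2)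
  simpa [monom] using this

theorem HardySpace.eval_add (f g : HardySpace n E) [CompleteSpace E] {z : Fin n → ℂ}
    (hz : z ∈ polydisc n) : (f + g).eval z = f.eval z + g.eval z := by
  unfold HardySpace.eval
  rw [← (summable_norm_eval f hz).of_norm.tsum_add (summable_norm_eval g hz).of_norm]
  exact tsum_congr fun k => by simp

theorem HardySpace.eval_smul (a : ℂ) (f : HardySpace n E) (z : Fin n → ℂ) :
    (a • f).eval z = a • f.eval z := by
  unfold HardySpace.eval
  rw [← tsum_const_smul'']
  exact tsum_congr fun k => by simp [smul_comm a]

theorem HardySpace.eval_injective [CompleteSpace E] {f g : HardySpace n E}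
    (h : ∀ z ∈ polydisc n, f.eval z = g.eval z) : f = g := by
  rw [← sub_eq_zero]
  have h0 : ∀ z ∈ polydisc n, (f - g).eval z = 0 := fun z hz => by
    rw [sub_eq_add_neg, ← neg_one_smul ℂ g, HardySpace.eval_add _ _ hz, HardySpace.eval_smul, h z hz]
    simp
  refine lp.ext (funext fun k => ?_)
  have := sum_le (c := (f - g : HardySpace n E)) (fun z hz => summable_norm_eval _ hz) (f - g)
    le_rfl (fun z hz => by
      have := h0 z hz
      rw [HardySpace.eval] at this
      rw [this]; simp) {k}
  simpa using this

theorem IsMulOp.unique [CompleteSpace E] {Γ : (Fin n → ℂ) → F →L[ℂ] E}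
    {M M' : HardySpace n F →L[ℂ] HardySpace n E} (h : IsMulOp Γ M) (h' : IsMulOp Γ M') :
    M = M' :=
  ContinuousLinearMap.ext fun f => HardySpace.eval_injective fun z hz =>
    (h f z hz).trans (h' f z hz).symm

theorem exists_mul [CompleteSpace E] [CompleteSpace F] {Γ : (Fin n → ℂ) → F →L[ℂ] E}
    {A : (Fin n → ℕ) → F →L[ℂ] E} (hA : HasTaylorCoeffs Γ A) {C : ℝ}
    (hC : ∀ z ∈ polydisc n, ‖Γ z‖ ≤ C) (f : HardySpace n F) :
    ∃ g : HardySpace n E, (∀ z ∈ polydisc n, g.eval z = Γ z (f.eval z)) ∧ ‖g‖ ≤ C * ‖f‖ := by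
  have hC0 : 0 ≤ C := (norm_nonneg _).trans (hC 0 fun i => by simp)
  let c : (Fin n → ℕ) → E := fun k =>
    ∑' p : (fun p : (Fin n → ℕ) × (Fin n → ℕ) => p.1 + p.2) ⁻¹' {k}, A p.1.1 (f p.1.2)
  let u : (Fin n → ℂ) → (Fin n → ℕ) × (Fin n → ℕ) → E := fun z p =>
    (monom z p.1 • A p.1) (monom z p.2 • f p.2)
  have hcu : ∀ z k, monom z k • c k =
      ∑' p : (fun p : (Fin n → ℕ) × (Fin n → ℕ) => p.1 + p.2) ⁻¹' {k}, u z p.1 := by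
    intro z k
    rw [← tsum_const_smul'']
    refine tsum_congr fun p => ?_
    have hp : p.1.1 + p.1.2 = k := p.2
    simp only [u, ← hp, monom_add, smul_apply, map_smul, mul_smul]
    exact smul_comm _ _ _
  have hun : ∀ z ∈ polydisc n, Summable fun p => ‖u z p‖ := by
    intro z hz
    refine Summable.of_nonneg_of_le (fun _ => norm_nonneg _) (fun p => ?_)
      ((hA.summable_norm hz).mul_of_nonneg (summable_norm_eval f hz)
        (fun _ => norm_nonneg _) fun _ => norm_nonneg _)
    exact ContinuousLinearMap.le_opNorm _ _
  have hsum : ∀ z ∈ polydisc n, HasSum (u z) (Γ z (f.eval z)) := by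
    intro z hz
    have hu := (hun z hz).of_norm
    have h1 : ∀ l, HasSum (fun m => u z (l, m)) ((monom z l • A l) (f.eval z)) := fun l =>
      (summable_norm_eval f hz).of_norm.hasSum.mapL (monom z l • A l)
    have h2 : HasSum (fun l => (monom z l • A l) (f.eval z)) (Γ z (f.eval z)) :=
      (hA z hz).mapL (ContinuousLinearMap.apply ℂ E (f.eval z))
    have h3 := hu.hasSum.prod_fiberwise h1
    rw [← h3.unique h2]
    exact hu.hasSum
  have hceval : ∀ z ∈ polydisc n, ∑' k, monom z k • c k = Γ z (f.eval z) := by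
    intro z hz
    rw [← ((hsum z hz).tsum_fiberwise fun p => p.1 + p.2).tsum_eq]
    exact tsum_congr fun k => hcu z k
  have hcs : ∀ z ∈ polydisc n, Summable fun k => ‖monom z k • c k‖ := by
    intro z hz
    refine Summable.of_nonneg_of_le (fun _ => norm_nonneg _) (fun k => ?_)
      ((hun z hz).hasSum.tsum_fiberwise fun p => p.1 + p.2).summable
    rw [hcu]
    exact norm_tsum_le_tsum_norm ((hun z hz).subtype _)
  have hle := sum_le hcs f hC0 (fun z hz => by
    rw [hceval z hz]; exact (Γ z).le_of_opNorm_le (hC z hz) _)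
  have hmem : Memℓp c 2 := memℓp_gen' (C := (C * ‖f‖) ^ 2) (fun s => by simpa using hle s)
  refine ⟨⟨c, hmem⟩, hceval, ?_⟩
  exact lp.norm_le_of_forall_sum_le (by norm_num) (by positivity) fun s => by simpa using hle s

theorem exists_isMulOp [CompleteSpace E] [CompleteSpace F] {Γ : (Fin n → ℂ) → F →L[ℂ] E}
    {A : (Fin n → ℕ) → F →L[ℂ] E} (hA : HasTaylorCoeffs Γ A) {C : ℝ}
    (hC : ∀ z ∈ polydisc n, ‖Γ z‖ ≤ C) :
    ∃ M : HardySpace n F →L[ℂ] HardySpace n E, IsMulOp Γ M := by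
  choose g hg hgn using exists_mul hA hC
  refine ⟨LinearMap.mkContinuous
    { toFun := g
      map_add' := fun f f' => HardySpace.eval_injective fun z hz => by
        rw [HardySpace.eval_add _ _ hz, hg _ z hz, hg _ z hz, hg _ z hz,
          HardySpace.eval_add _ _ hz, map_add]
      map_smul' := fun a f => HardySpace.eval_injective fun z hz => by
        rw [RingHom.id_apply, HardySpace.eval_smul, hg _ z hz, hg _ z hz,
          HardySpace.eval_smul, map_smul] } C hgn, fun f z hz => hg f z hz⟩

theorem isMulOp_mulOp [CompleteSpace E] [CompleteSpace F] {Γ : (Fin n → ℂ) → F →L[ℂ] E}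
    (hΓ : IsHInfty Γ) {A : (Fin n → ℕ) → F →L[ℂ] E} (hA : HasTaylorCoeffs Γ A) :
    IsMulOp Γ (mulOp Γ) := by
  obtain ⟨C, hC⟩ := hΓ.bounded
  have h := exists_isMulOp hA hC
  rw [mulOp, dif_pos h]
  exact h.choose_spec

end PolydiscHardy

end

open PolydiscHardy

namespace PolydiscHardy

open Filter Topology

/-! ### Matrix entries of multiplication operators and their adjoints -/

section Coefficients

variable {n : ℕ} {E F : Type*}
  [NormedAddCommGroup E] [InnerProductSpace ℂ E] [CompleteSpace E]
  [NormedAddCommGroup F] [InnerProductSpace ℂ F] [CompleteSpace F]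

/-! In the monomial basis `M_Γ M_Ψ^*` has the operator entries `T_{jk} = ∑_{p ≤ j ⊓ k} A_{j-p}
B_{k-p}^*` (`mulOp_adjoint_single_apply`), while the entries of a Toeplitz operator are Fourier
coefficients of its symbol and depend only on `j - k`.

Necessity: shift `(l, m)` by `e_i`. The terms of the new sum with `p_i ≥ 1` reproduce the old sum,
so those with `p_i = 0` add up to zero. The term `p = 0` is `A_{l+e_i} B_{m+e_i}^*`; the others have
the same form with `l - p`, `m - p` in place of `l`, `m`, and vanish by induction on `|l|`
(`eq_zero_of_shift_invariant`).

Sufficiency: the condition says that `A_l B_m^* = 0` as soon as `l` and `m` have a common nonzero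
coordinate. Pairs with disjoint supports are exactly the pairs `(d⁺, d⁻)` with `d ∈ ℤⁿ`. Hence only
`p = j ⊓ k` contributes to `T_{jk}`, which equals `a_d = A_{d⁺} B_{d⁻}^*` for `d = j - k`. The same
cancellation turns `Γ(z) Ψ(z)^*` on the torus of radius `r < 1` into the Poisson mean of the Fourier
series `∑ a_d e^{i⟨d,θ⟩}` (`hasSum_mul_adjoint`), so these means are bounded by `‖Γ‖_∞ ‖Ψ‖_∞`. Such
a series is that of an `L^∞` symbol (`exists_isLInfty_of_poisson_le`). As `E` may be nonseparable,
the boundary function of `a_d x` has a null set depending on `x`; `exists_isLInfty` chooses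
representatives linear in `x` through averages over small balls. -/

theorem coeff_unique {c : (Fin n → ℕ) → E}
    (hc : ∀ z ∈ polydisc n, Summable fun k => ‖monom z k • c k‖) (g : HardySpace n E)
    (h : ∀ z ∈ polydisc n, ∑' k, monom z k • c k = g.eval z) (k : Fin n → ℕ) : c k = g k := by
  have hsub : ∀ z ∈ polydisc n, Summable fun k => ‖monom z k • (c k - g k)‖ := fun z hz => by
    refine ((hc z hz).add (summable_norm_eval g hz)).of_nonneg_of_le (fun _ => norm_nonneg _)
      fun k => ?_
    rw [smul_sub]
    exact norm_sub_le _ _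
  have := sum_le hsub (0 : HardySpace n E) le_rfl (fun z hz => by
    have h1 : ∑' k, monom z k • (c k - g k) = 0 := by
      simp_rw [smul_sub]
      rw [(hc z hz).of_norm.tsum_sub (summable_norm_eval g hz).of_norm, h z hz, HardySpace.eval,
        sub_self]
    simp [h1]) {k}
  have h2 : ‖c k - g k‖ ^ 2 ≤ 0 := by simpa using this
  have h3 : ‖c k - g k‖ = 0 := by
    have := sq_nonneg ‖c k - g k‖
    exact pow_eq_zero_iff two_ne_zero |>.mp (le_antisymm h2 this)
  exact sub_eq_zero.mp (norm_eq_zero.mp h3)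

theorem eval_single {G : Type*} [NormedAddCommGroup G] [InnerProductSpace ℂ G]
    (p : Fin n → ℕ) (u : G) (z : Fin n → ℂ) :
    HardySpace.eval (lp.single 2 p u : HardySpace n G) z = monom z p • u := by
  rw [HardySpace.eval, tsum_eq_single p]
  · simp
  · intro k hk
    simp [Pi.single_eq_of_ne hk]

-- Multiplying the monomial `z ^ p u` by `Γ` shifts the Taylor series of `Γ u` by `p`;
-- `coeff_unique` then identifies the coefficients.
open Classical in
theorem mulOp_single_apply {Γ : (Fin n → ℂ) → F →L[ℂ] E} (hΓ : IsHInfty Γ)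
    {A : (Fin n → ℕ) → F →L[ℂ] E} (hA : HasTaylorCoeffs Γ A) (p k : Fin n → ℕ) (u : F) :
    mulOp Γ (lp.single 2 p u) k = if p ≤ k then A (k - p) u else 0 := by
  have hinj : Function.Injective fun l : Fin n → ℕ => l + p := add_left_injective p
  have hzero : ∀ (z : Fin n → ℂ) (k : Fin n → ℕ), k ∉ Set.range (fun l : Fin n → ℕ => l + p) →
      monom z k • (if p ≤ k then A (k - p) u else 0) = 0 := fun z k hk => by
    rw [if_neg, smul_zero]
    exact fun h => hk ⟨k - p, tsub_add_cancel_of_le h⟩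
  have hcomp : ∀ z, (fun k => monom z k • (if p ≤ k then A (k - p) u else 0)) ∘
      (fun l : Fin n → ℕ => l + p) = fun l => (monom z l • A l) (monom z p • u) := by
    intro z
    funext l
    simp only [Function.comp_apply, monom_add, le_add_iff_nonneg_left, zero_le, if_true,
      add_tsub_cancel_right, smul_apply, map_smul, mul_smul]
    exact smul_comm _ _ _
  symm
  refine coeff_unique (c := fun k => if p ≤ k then A (k - p) u else 0) (fun z hz => ?_)
    (mulOp Γ (lp.single 2 p u)) (fun z hz => ?_) k
  · refine (hinj.summable_iff (fun k hk => ?_)).mp ?_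
    · rw [hzero z k hk, norm_zero]
    · refine ((hA.summable_norm hz).mul_right ‖monom z p • u‖).of_nonneg_of_le
        (fun _ => norm_nonneg _) fun l => ?_
      have := congrFun (hcomp z) l
      simp only [Function.comp_apply] at this ⊢
      rw [this]
      exact ContinuousLinearMap.le_opNorm _ _
  · rw [isMulOp_mulOp hΓ hA _ z hz, eval_single]
    refine ((hinj.hasSum_iff (hzero z)).mp ?_).tsum_eq
    rw [hcomp]
    exact (hA z hz).mapL (ContinuousLinearMap.apply ℂ E (monom z p • u))

-- This is the conjugate transpose of the matrix of `mulOp Ψ`. The adjoint sends monomials to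
-- polynomials, which is why the entries of the product are finite sums.
open Classical in
theorem adjoint_mulOp_single_apply {Ψ : (Fin n → ℂ) → F →L[ℂ] E} (hΨ : IsHInfty Ψ)
    {B : (Fin n → ℕ) → F →L[ℂ] E} (hB : HasTaylorCoeffs Ψ B) (k p : Fin n → ℕ) (x : E) :
    (ContinuousLinearMap.adjoint (mulOp Ψ)) (lp.single 2 k x) p =
      if p ≤ k then ContinuousLinearMap.adjoint (B (k - p)) x else 0 := by
  refine ext_inner_right ℂ fun u => ?_
  rw [← lp.inner_single_right (G := fun _ : Fin n → ℕ => F) p,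
    ContinuousLinearMap.adjoint_inner_left, lp.inner_single_left, mulOp_single_apply hΨ hB]
  split_ifs
  · rw [ContinuousLinearMap.adjoint_inner_left]
  · simp

open Classical in
/-- The matrix entries of `M_Γ M_Ψ^*`. -/
theorem mulOp_adjoint_single_apply {Γ Ψ : (Fin n → ℂ) → F →L[ℂ] E}
    (hΓ : IsHInfty Γ) (hΨ : IsHInfty Ψ) {A B : (Fin n → ℕ) → F →L[ℂ] E}
    (hA : HasTaylorCoeffs Γ A) (hB : HasTaylorCoeffs Ψ B) (j k : Fin n → ℕ) (x : E) :
    (mulOp Γ ∘L ContinuousLinearMap.adjoint (mulOp Ψ)) (lp.single 2 k x) j =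
      ∑ p ∈ Finset.Iic (j ⊓ k), A (j - p) (ContinuousLinearMap.adjoint (B (k - p)) x) := by
  refine ext_inner_right ℂ fun y => ?_
  -- With `M_Γ` moved to the other side, the entry is an inner product of two polynomials whose
  -- supports lie in `p ≤ k` and `p ≤ j`.
  rw [← lp.inner_single_right (G := fun _ : Fin n → ℕ => E) j, ContinuousLinearMap.comp_apply,
    ← ContinuousLinearMap.adjoint_inner_right, lp.inner_eq_tsum, sum_inner,
    tsum_eq_sum (s := Finset.Iic (j ⊓ k))]
  · refine Finset.sum_congr rfl fun p hp => ?_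
    obtain ⟨hj, hk⟩ := le_inf_iff.mp (Finset.mem_Iic.mp hp)
    rw [adjoint_mulOp_single_apply hΨ hB, adjoint_mulOp_single_apply hΓ hA, if_pos hj, if_pos hk,
      ContinuousLinearMap.adjoint_inner_right]
  · intro p hp
    rw [adjoint_mulOp_single_apply hΨ hB, adjoint_mulOp_single_apply hΓ hA]
    by_cases hj : p ≤ j
    · rw [if_neg (fun hk => hp (Finset.mem_Iic.mpr (le_inf hj hk))), inner_zero_left]
    · rw [if_neg hj, inner_zero_right]

end Coefficients

/-! ### Comparison of matrix entries and shift invariance -/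

/-- Two operators on the Hardy space with the same matrix entries coincide. -/
theorem ext_single {n : ℕ} {E : Type*} [NormedAddCommGroup E] [InnerProductSpace ℂ E]
    {S T : HardySpace n E →L[ℂ] HardySpace n E}
    (h : ∀ (j k : Fin n → ℕ) (x : E), S (lp.single 2 k x) j = T (lp.single 2 k x) j) : S = T := by
  refine ContinuousLinearMap.ext fun f => ?_
  have hf := lp.hasSum_single (E := fun _ : Fin n → ℕ => E) (p := 2) (by norm_num) f
  refine (hf.mapL S).unique ?_
  convert hf.mapL T using 2 with k
  exact lp.ext (funext fun j => h j k (f k))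

/-- If the entries `∑_{p ≤ j ⊓ k} A_{j-p} B_{k-p}^*` do not change under the shift
`(j, k) ↦ (j + e_i, k + e_i)`, then `A_{l+e_i} B_{m+e_i}^* = 0`. -/
theorem eq_zero_of_shift_invariant {n : ℕ} {R : Type*} [AddCommGroup R]
    (a : (Fin n → ℕ) → (Fin n → ℕ) → R) (i : Fin n)
    (h : ∀ j k : Fin n → ℕ,
      ∑ p ∈ Finset.Iic ((j + Pi.single i 1) ⊓ (k + Pi.single i 1)),
        a (j + Pi.single i 1 - p) (k + Pi.single i 1 - p) =
      ∑ p ∈ Finset.Iic (j ⊓ k), a (j - p) (k - p)) (l m : Fin n → ℕ) :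
    a (l + Pi.single i 1) (m + Pi.single i 1) = 0 := by
  classical
  set e : Fin n → ℕ := Pi.single i 1 with he
  -- Induction on the total degree of `l`, with `m` free.
  induction hN : ∑ r, l r using Nat.strong_induction_on generalizing l m with
  | _ N ih =>
    subst hN
    have hsplit := Finset.sum_filter_add_sum_filter_not (Finset.Iic ((l + e) ⊓ (m + e)))
      (fun p => e ≤ p) fun p => a (l + e - p) (m + e - p)
    -- Reindexing by `p ↦ p + e` identifies the terms with `p ≥ e` with the unshifted entry; after
    -- cancellation the terms with `p i = 0` sum to zero.
    have h1 : ∑ p ∈ (Finset.Iic ((l + e) ⊓ (m + e))).filter (fun p => e ≤ p),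
        a (l + e - p) (m + e - p) = ∑ p ∈ Finset.Iic (l ⊓ m), a (l - p) (m - p) := by
      symm
      refine Finset.sum_bij (fun p _ => p + e) (fun p hp => ?_) (fun p _ q _ hpq => ?_)
        (fun q hq => ?_) fun p _ => ?_
      · have := le_inf_iff.mp (Finset.mem_Iic.mp hp)
        simp [this.1, this.2]
      · exact add_right_cancel hpq
      · obtain ⟨h1, h2⟩ := Finset.mem_filter.mp hq
        obtain ⟨h3, h4⟩ := le_inf_iff.mp (Finset.mem_Iic.mp h1)
        exact ⟨q - e, Finset.mem_Iic.mpr (le_inf (tsub_le_iff_right.mpr h3)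
          (tsub_le_iff_right.mpr h4)), tsub_add_cancel_of_le h2⟩
      · simp only [add_tsub_add_eq_tsub_right]
    rw [h1, h l m, add_eq_left] at hsplit
    rw [Finset.sum_eq_single 0] at hsplit
    · simpa using hsplit
    · intro p hp hp0
      obtain ⟨h2, h3⟩ := Finset.mem_filter.mp hp
      obtain ⟨h4, h5⟩ := le_inf_iff.mp (Finset.mem_Iic.mp h2)
      have hpi : p i = 0 := by
        by_contra hne
        refine h3 fun r => ?_
        by_cases hr : r = i
        · subst hr; simp only [he, Pi.single_eq_same]; omega
        · simp [he, Pi.single_eq_of_ne hr]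
      have hle : ∀ c : Fin n → ℕ, p ≤ c + e → p ≤ c := fun c hc r => by
        by_cases hr : r = i
        · rw [hr, hpi]; exact Nat.zero_le _
        · have := hc r
          simpa [he, Pi.single_eq_of_ne hr] using this
      have hl := hle l h4
      -- Since `p i = 0`, the bound `p ≤ l + e` gives `p ≤ l` and `l + e - p = (l - p) + e`,
      -- likewise for `m`; as `p ≠ 0`, the degree of `l - p` is smaller.
      rw [tsub_add_eq_add_tsub hl |>.symm, tsub_add_eq_add_tsub (hle m h5) |>.symm]
      refine ih (∑ r, (l - p) r) ?_ (l - p) (m - p) rfl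
      obtain ⟨r, hr⟩ : ∃ r, p r ≠ 0 := by
        by_contra! hcon
        exact hp0 (funext hcon)
      refine Finset.sum_lt_sum (fun r _ => Nat.sub_le _ _) ⟨r, Finset.mem_univ r, ?_⟩
      exact Nat.sub_lt ((Nat.pos_of_ne_zero hr).trans_le (hl r)) (Nat.pos_of_ne_zero hr)
    · intro h0
      refine absurd (Finset.mem_filter.mpr ⟨Finset.mem_Iic.mpr zero_le, fun hcon => ?_⟩) h0
      have := hcon i
      simp [he] at this

end PolydiscHardy

namespace PolydiscHardy

open Filter Topology

/-! ### Generalized weak operator limits -/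

section WeakLimit

variable {E : Type*} [NormedAddCommGroup E] [InnerProductSpace ℂ E] [CompleteSpace E]

/-- A bounded sequence of operators has a generalized limit in the weak operator topology, which
agrees with the strong limit at each vector where the latter exists. -/
theorem exists_weak_limit (a : ℕ → E →L[ℂ] E) {C : ℝ} (hC : 0 ≤ C)
    (ha : ∀ j x, ‖a j x‖ ≤ C * ‖x‖) :
    ∃ T : E →L[ℂ] E, ‖T‖ ≤ C ∧
      ∀ x z, Tendsto (fun j => a j x) atTop (𝓝 z) → T x = z := by
  -- Along an ultrafilter every bounded scalar sequence converges, with no choice of subsequence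
  -- depending on the vectors; the limits are therefore sesquilinear in `(x, y)`.
  let U : Ultrafilter ℕ := hyperfilter ℕ
  have hU : (U : Filter ℕ) ≤ atTop := Nat.hyperfilter_le_atTop
  have hbd : ∀ x y j, ‖inner ℂ (a j x) y‖ ≤ C * ‖x‖ * ‖y‖ := fun x y j =>
    (norm_inner_le_norm _ _).trans (mul_le_mul_of_nonneg_right (ha j x) (norm_nonneg _))
  have hlim : ∀ x y, ∃ c : ℂ, Tendsto (fun j => inner ℂ (a j x) y) U (𝓝 c) := by
    intro x y
    obtain ⟨c, -, hc⟩ := (isCompact_closedBall (0 : ℂ) (C * ‖x‖ * ‖y‖)).ultrafilter_le_nhds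
      (U.map fun j => inner ℂ (a j x) y) (by
        rw [le_principal_iff, Ultrafilter.mem_coe, Ultrafilter.mem_map]
        exact univ_mem' fun j => mem_closedBall_zero_iff.mpr (hbd x y j))
    exact ⟨c, hc⟩
  choose b hb using hlim
  let B : E →ₗ⋆[ℂ] E →ₗ[ℂ] ℂ := LinearMap.mk₂'ₛₗ (starRingEnd ℂ) (RingHom.id ℂ) b
    (fun x x' y => tendsto_nhds_unique (hb _ _) (by
      simpa only [map_add, inner_add_left] using (hb x y).add (hb x' y)))
    (fun c x y => tendsto_nhds_unique (hb _ _) (by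
      simpa only [map_smul, inner_smul_left, smul_eq_mul] using (hb x y).const_mul _))
    (fun x y y' => tendsto_nhds_unique (hb _ _) (by
      simpa only [inner_add_right] using (hb x y).add (hb x y')))
    (fun c x y => tendsto_nhds_unique (hb _ _) (by
      simpa only [inner_smul_right, smul_eq_mul, RingHom.id_apply] using (hb x y).const_mul _))
  have hB : ∀ x y, ‖B x y‖ ≤ C * ‖x‖ * ‖y‖ := fun x y =>
    le_of_tendsto (hb x y).norm (Eventually.of_forall (hbd x y))
  have hT : ∀ x y, inner ℂ (InnerProductSpace.continuousLinearMapOfBilin (B.mkContinuous₂ C hB) x) y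
      = b x y := fun x y => InnerProductSpace.continuousLinearMapOfBilin_apply _ x y
  refine ⟨InnerProductSpace.continuousLinearMapOfBilin (B.mkContinuous₂ C hB), ?_, ?_⟩
  · refine ContinuousLinearMap.opNorm_le_bound _ hC fun x => ?_
    set w := InnerProductSpace.continuousLinearMapOfBilin (B.mkContinuous₂ C hB) x with hw
    have h1 : ‖w‖ * ‖w‖ ≤ C * ‖x‖ * ‖w‖ := by
      have h2 : ‖inner ℂ w w‖ = ‖w‖ * ‖w‖ := by
        rw [inner_self_eq_norm_sq_to_K, norm_pow, RCLike.norm_ofReal, abs_norm, sq]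
      rw [← h2]
      nth_rewrite 1 [hw]
      rw [hT]
      exact hB x _
    by_cases hw0 : ‖w‖ = 0
    · rw [hw0]; positivity
    · exact le_of_mul_le_mul_right h1 (lt_of_le_of_ne (norm_nonneg _) (Ne.symm hw0))
  · intro x z hz
    refine ext_inner_right ℂ fun y => ?_
    rw [hT]
    exact tendsto_nhds_unique (hb x y) ((hz.mono_left hU).inner tendsto_const_nhds)

end WeakLimit

/-! ### Operator-valued symbols from vector-valued boundary functions -/

section Symbol

variable {n : ℕ} {E : Type*} [NormedAddCommGroup E] [InnerProductSpace ℂ E] [CompleteSpace E]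

theorem haarAddCircle_closedBall (x : UnitAddCircle) (r : ℝ) :
    AddCircle.haarAddCircle (Metric.closedBall x r) = ENNReal.ofReal (min 1 (2 * r)) := by
  rw [← AddCircle.volume_closedBall 1 (x := x), AddCircle.volume_eq_smul_haarAddCircle]
  simp

/-- A ball in the sup metric is a product of `n` arcs of measure `min 1 (2r)`, and doubling `r` at
most doubles each factor. This gives Lebesgue differentiation on the torus. -/
instance : IsUnifLocDoublingMeasure (torusMeasure n) where
  exists_measure_closedBall_le_mul'' := by
    refine ⟨2 ^ n, ?_⟩
    filter_upwards [self_mem_nhdsWithin] with r hr x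
    have hr0 : (0 : ℝ) < r := hr
    rw [torusMeasure, Measure.pi_closedBall _ _ (by positivity),
      Measure.pi_closedBall _ _ hr0.le]
    simp only [haarAddCircle_closedBall, Finset.prod_const, Finset.card_univ, Fintype.card_fin]
    push_cast
    rw [← mul_pow]
    gcongr
    rw [show (2 : ℝ≥0∞) = ENNReal.ofReal 2 by simp, ← ENNReal.ofReal_mul (by norm_num)]
    refine ENNReal.ofReal_le_ofReal ?_
    rw [mul_min_of_nonneg _ _ (by norm_num)]
    exact min_le_min (by norm_num) le_rfl

/-- A linear map `x ↦ φ x` into `L²_E(𝕋ⁿ)` with `‖φ x‖ ≤ C ‖x‖` almost everywhere (the null set may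
depend on `x`) is given by an operator-valued `L^∞` function. -/
theorem exists_isLInfty (φ : E →ₗ[ℂ] L2Torus n E) {C : ℝ} (hC : 0 ≤ C)
    (hφ : ∀ x, ∀ᵐ t ∂(torusMeasure n), ‖φ x t‖ ≤ C * ‖x‖) :
    ∃ Φ : UnitAddTorus (Fin n) → E →L[ℂ] E, IsLInfty Φ ∧
      ∀ x, (fun t => Φ t x) =ᵐ[torusMeasure n] φ x := by
  have hint : ∀ x, Integrable (φ x) (torusMeasure n) := fun x =>
    (Lp.memLp (φ x)).integrable (by norm_num)
  let δ : ℕ → ℝ := fun j => 1 / ((j : ℝ) + 1)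
  have hδ : Tendsto δ atTop (𝓝[>] 0) := tendsto_nhdsWithin_iff.mpr
    ⟨tendsto_one_div_add_atTop_nhds_zero_nat, Eventually.of_forall fun j => by
      simp only [δ, Set.mem_Ioi]; positivity⟩
  -- Unlike the values of `φ x`, the averages are linear in `x` and bounded by `C * ‖x‖` at every
  -- point `t`, with no exceptional set.
  let avg : UnitAddTorus (Fin n) → ℕ → E → E := fun t j x =>
    ⨍ s in Metric.closedBall t (δ j), φ x s ∂(torusMeasure n)
  have havg : ∀ t j x, ‖avg t j x‖ ≤ C * ‖x‖ := by
    intro t j x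
    have h1 := norm_setIntegral_le_of_norm_le_const_ae (s := Metric.closedBall t (δ j))
      (measure_lt_top (torusMeasure n) _) (ae_restrict_of_ae (hφ x))
    have h2 : avg t j x = ((torusMeasure n).real (Metric.closedBall t (δ j)))⁻¹ •
      ∫ s in Metric.closedBall t (δ j), φ x s ∂(torusMeasure n) := setAverage_eq _ _ _
    rw [h2, norm_smul, norm_inv, Real.norm_of_nonneg measureReal_nonneg]
    refine inv_mul_le_of_le_mul₀ measureReal_nonneg (by positivity) ?_
    rwa [mul_comm]
  let a : UnitAddTorus (Fin n) → ℕ → E →L[ℂ] E := fun t j => LinearMap.mkContinuous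
    { toFun := avg t j
      map_add' := fun x y => by
        simp only [avg, setAverage_eq, map_add]
        rw [← smul_add, ← integral_add (hint x).integrableOn (hint y).integrableOn]
        congr 1
        exact integral_congr_ae (ae_restrict_of_ae (Lp.coeFn_add (φ x) (φ y)))
      map_smul' := fun c x => by
        simp only [avg, setAverage_eq, map_smul, RingHom.id_apply]
        rw [smul_comm c, ← integral_smul c]
        congr 1
        exact integral_congr_ae (ae_restrict_of_ae (Lp.coeFn_smul c (φ x))) } C (havg t j)
  choose Φ hΦn hΦ using fun t => exists_weak_limit (a t) hC (havg t)
  have hae : ∀ x, (fun t => Φ t x) =ᵐ[torusMeasure n] φ x := by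
    intro x
    -- At a Lebesgue point of `φ x` the averages converge strongly, so the generalized limit is the
    -- true value there; measurability of `Φ · x` follows from this.
    filter_upwards [IsUnifLocDoublingMeasure.ae_tendsto_average (torusMeasure n)
      (hint x).locallyIntegrable 1] with t ht
    refine hΦ t x _ (ht (fun _ => t) δ hδ (Eventually.of_forall fun j => ?_))
    refine Metric.mem_closedBall_self ?_
    simp only [δ]; positivity
  exact ⟨Φ, ⟨fun x => (Lp.aestronglyMeasurable (φ x)).congr (hae x).symm,
    ⟨C, Eventually.of_forall hΦn⟩⟩, hae⟩

end Symbol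

end PolydiscHardy

namespace PolydiscHardy

open Filter Topology

/-! ### Fourier series on the torus and Poisson means -/

section Fourier

variable {n : ℕ} {E : Type*} [NormedAddCommGroup E] [InnerProductSpace ℂ E]

/-- The function `t ↦ exp (2 π i ⟨d, t⟩) x` for `d ∈ ℤⁿ`. -/
noncomputable def fourierMonomial (d : Fin n → ℤ) : E →ₗ[ℂ] C(UnitAddTorus (Fin n), E) where
  toFun x := ⟨fun t => UnitAddTorus.mFourier d t • x, by fun_prop⟩
  map_add' x y := by ext t; simp
  map_smul' c x := by ext t; simp [smul_comm c]

theorem fourierMonomial_apply (d : Fin n → ℤ) (x : E) (t : UnitAddTorus (Fin n)) :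
    fourierMonomial d x t = UnitAddTorus.mFourier d t • x := rfl

theorem conj_mFourier (d : Fin n → ℤ) (t : UnitAddTorus (Fin n)) :
    (starRingEnd ℂ) (UnitAddTorus.mFourier d t) = UnitAddTorus.mFourier (-d) t :=
  UnitAddTorus.mFourier_neg.symm

theorem fourierMonomial_inner (d d' : Fin n → ℤ) (x y : E) :
    inner ℂ (ContinuousMap.toLp (E := E) 2 (torusMeasure n) ℂ (fourierMonomial d x))
      (ContinuousMap.toLp (E := E) 2 (torusMeasure n) ℂ (fourierMonomial d' y)) =
    if d = d' then inner ℂ x y else 0 := by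
  have h := orthonormal_iff_ite.mp (UnitAddTorus.orthonormal_mFourier (d := Fin n)) d d'
  rw [ContinuousMap.inner_toLp] at h
  change ∫ t, _ ∂(torusMeasure n) = _ at h
  rw [L2.inner_def]
  have h2 : ∀ᵐ t ∂(torusMeasure n),
      inner ℂ (ContinuousMap.toLp (E := E) 2 (torusMeasure n) ℂ (fourierMonomial d x) t)
        (ContinuousMap.toLp (E := E) 2 (torusMeasure n) ℂ (fourierMonomial d' y) t) =
      (UnitAddTorus.mFourier d' t *
        (starRingEnd ℂ) (UnitAddTorus.mFourier d t)) * inner ℂ x y := by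
    filter_upwards [ContinuousMap.coeFn_toLp (p := 2) (𝕜 := ℂ) (torusMeasure n)
      (fourierMonomial d x), ContinuousMap.coeFn_toLp (p := 2) (𝕜 := ℂ) (torusMeasure n)
      (fourierMonomial d' y)] with t h1 h2
    rw [h1, h2, fourierMonomial_apply, fourierMonomial_apply, inner_smul_left, inner_smul_right]
    ring
  rw [integral_congr_ae h2, integral_mul_const, h]
  simp

/-- The isometric embedding `x ↦ exp (2 π i ⟨d, t⟩) x` of `E` into `L²_E(𝕋ⁿ)`. -/
noncomputable def fourierMonomialLp (d : Fin n → ℤ) : E →ₗᵢ[ℂ] L2Torus n E where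
  toLinearMap := (ContinuousMap.toLp (E := E) 2 (torusMeasure n) ℂ).toLinearMap ∘ₗ
    fourierMonomial d
  norm_map' x := by
    have h := fourierMonomial_inner d d x x
    rw [if_pos rfl, inner_self_eq_norm_sq_to_K, inner_self_eq_norm_sq_to_K] at h
    have h' := (sq_eq_sq₀ (norm_nonneg _) (norm_nonneg _)).mp (by exact_mod_cast h)
    exact h'

theorem fourierMonomialLp_ae (d : Fin n → ℤ) (x : E) :
    fourierMonomialLp d x =ᵐ[torusMeasure n] fun t => UnitAddTorus.mFourier d t • x :=
  ContinuousMap.coeFn_toLp (p := 2) (𝕜 := ℂ) (torusMeasure n) (fourierMonomial d x)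

theorem trigMonomialLp_ae (k : Fin n → ℕ) (x : E) :
    trigMonomialLp k x =ᵐ[torusMeasure n]
      fun t => UnitAddTorus.mFourier (fun i => (k i : ℤ)) t • x :=
  ContinuousMap.coeFn_toLp (p := 2) (𝕜 := ℂ) (torusMeasure n) (trigMonomial k x)

theorem orthogonalFamily_fourierMonomialLp :
    OrthogonalFamily ℂ (fun _ : Fin n → ℤ => E) (fourierMonomialLp (n := n) (E := E)) := by
  intro k l hkl x y
  exact (fourierMonomial_inner k l x y).trans (if_neg hkl)

theorem memlp_two_of_sum_le {ι G : Type*} [NormedAddCommGroup G] {c : ι → G} {K : ℝ}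
    (h : ∀ s : Finset ι, ∑ d ∈ s, ‖c d‖ ^ 2 ≤ K ^ 2) : Memℓp c 2 :=
  memℓp_gen' (C := K ^ 2) fun s => by simpa using h s

theorem memlp_two_of_summable_norm {ι G : Type*} [NormedAddCommGroup G] {c : ι → G} (hc : Summable fun d => ‖c d‖) :
    Memℓp c 2 := by
  have h : Memℓp c 1 := memℓp_gen (by simpa using hc)
  exact h.of_exponent_ge (by norm_num)

variable [CompleteSpace E]

/-- The isometry from square-summable families on `ℤⁿ` to `L²_E(𝕋ⁿ)`. -/
noncomputable def fourierSeries (n : ℕ) (E : Type*) [NormedAddCommGroup E] [InnerProductSpace ℂ E]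
    [CompleteSpace E] : lp (fun _ : Fin n → ℤ => E) 2 →ₗᵢ[ℂ] L2Torus n E :=
  orthogonalFamily_fourierMonomialLp.linearIsometry

theorem fourierSeries_inner (c : lp (fun _ : Fin n → ℤ => E) 2) (d : Fin n → ℤ) (y : E) :
    inner ℂ (fourierSeries n E c) (fourierMonomialLp d y) = inner ℂ (c d) y := by
  classical
  rw [fourierSeries, ← orthogonalFamily_fourierMonomialLp.linearIsometry_apply_single,
    LinearIsometry.inner_map_map, lp.inner_single_right]

/-- Absolute summability makes the series converge uniformly, so its `L²` sum is represented by the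
pointwise sum. -/
theorem fourierSeries_ae_eq (c : lp (fun _ : Fin n → ℤ => E) 2) (hc : Summable fun d => ‖c d‖) :
    fourierSeries n E c =ᵐ[torusMeasure n]
      fun t => ∑' d, UnitAddTorus.mFourier d t • c d := by
  have hs : Summable fun d => fourierMonomial d (c d) := by
    refine Summable.of_norm_bounded hc fun d => ?_
    refine (ContinuousMap.norm_le _ (norm_nonneg _)).mpr fun t => ?_
    rw [fourierMonomial_apply, norm_smul]
    refine mul_le_of_le_one_left (norm_nonneg _) ?_
    exact (ContinuousMap.norm_coe_le_norm _ t).trans UnitAddTorus.mFourier_norm.le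
  have h1 := hs.hasSum.mapL (ContinuousMap.toLp (E := E) 2 (torusMeasure n) ℂ)
  have h2 := orthogonalFamily_fourierMonomialLp.hasSum_linearIsometry c
  have h3 : fourierSeries n E c = ContinuousMap.toLp (E := E) 2 (torusMeasure n) ℂ
    (∑' d, fourierMonomial d (c d)) := h2.unique h1
  rw [h3]
  filter_upwards [ContinuousMap.coeFn_toLp (p := 2) (𝕜 := ℂ) (torusMeasure n)
    (∑' d, fourierMonomial d (c d))] with t ht
  rw [ht]
  exact (ContinuousMap.tsum_apply hs t).symm

/-- The Poisson weight `r ^ (|d₁| + ⋯ + |dₙ|)`. -/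
def poissonWeight (r : ℝ) (d : Fin n → ℤ) : ℝ := ∏ i, r ^ (d i).natAbs

theorem poissonWeight_nonneg {r : ℝ} (h0 : 0 ≤ r) (d : Fin n → ℤ) : 0 ≤ poissonWeight r d :=
  Finset.prod_nonneg fun _ _ => by positivity

theorem poissonWeight_le_one {r : ℝ} (h0 : 0 ≤ r) (h1 : r ≤ 1) (d : Fin n → ℤ) :
    poissonWeight r d ≤ 1 :=
  Finset.prod_le_one (fun _ _ => by positivity) fun _ _ => pow_le_one₀ h0 h1

theorem continuous_poissonWeight (d : Fin n → ℤ) : Continuous fun r => poissonWeight r d := by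
  unfold poissonWeight; fun_prop

theorem poissonWeight_one (d : Fin n → ℤ) : poissonWeight 1 d = 1 := by simp [poissonWeight]

/-- A Fourier series whose Poisson means are bounded by `K` has square-summable coefficients. -/
theorem sum_sq_le_of_poisson_le {c : (Fin n → ℤ) → E} {K : ℝ}
    (hs : ∀ r : ℝ, 0 ≤ r → r < 1 → Summable fun d => ‖(poissonWeight r d : ℂ) • c d‖)
    (hb : ∀ r : ℝ, 0 ≤ r → r < 1 → ∀ t : UnitAddTorus (Fin n),
      ‖∑' d, UnitAddTorus.mFourier d t • (poissonWeight r d : ℂ) • c d‖ ≤ K)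
    (s : Finset (Fin n → ℤ)) : ∑ d ∈ s, ‖c d‖ ^ 2 ≤ K ^ 2 := by
  have hdil : ∀ r : ℝ, 0 ≤ r → r < 1 →
      ∑ d ∈ s, ‖(poissonWeight r d : ℂ) • c d‖ ^ 2 ≤ K ^ 2 := by
    intro r h0 h1
    let b : lp (fun _ : Fin n → ℤ => E) 2 := ⟨_, memlp_two_of_summable_norm (hs r h0 h1)⟩
    -- On a probability space the sup bound also bounds the `L²` norm, which is the `ℓ²` norm of the
    -- coefficients.
    have hbn : ‖fourierSeries n E b‖ ≤ K := by
      have hK : 0 ≤ K := (norm_nonneg _).trans (hb r h0 h1 0)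
      have := Lp.norm_le_of_ae_bound (f := fourierSeries n E b) hK (by
        filter_upwards [fourierSeries_ae_eq b (hs r h0 h1)] with t ht
        rw [ht]
        exact hb r h0 h1 t)
      simpa [measureUnivNNReal] using this
    rw [LinearIsometry.norm_map] at hbn
    have h2 := lp.sum_rpow_le_norm_rpow (p := 2) (by norm_num) b s
    simp only [ENNReal.toReal_ofNat, Real.rpow_ofNat] at h2
    exact h2.trans (pow_le_pow_left₀ (norm_nonneg _) hbn 2)
  have hcont : Continuous fun r : ℝ => ∑ d ∈ s, ‖(poissonWeight r d : ℂ) • c d‖ ^ 2 := by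
    unfold poissonWeight; fun_prop
  have ht := (hcont.tendsto 1).mono_left (nhdsWithin_le_nhds (s := Set.Iio 1))
  have := le_of_tendsto ht (b := K ^ 2) (by
    filter_upwards [Ioo_mem_nhdsLT (zero_lt_one (α := ℝ))] with r hr
    exact hdil r hr.1.le hr.2)
  simpa [poissonWeight_one] using this

/-- A Fourier series whose Poisson means are bounded by `K` is essentially bounded by `K`. -/
theorem fourierSeries_ae_le_of_poisson_le (c : lp (fun _ : Fin n → ℤ => E) 2) {K : ℝ}
    (hs : ∀ r : ℝ, 0 ≤ r → r < 1 → Summable fun d => ‖(poissonWeight r d : ℂ) • c d‖)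
    (hb : ∀ r : ℝ, 0 ≤ r → r < 1 → ∀ t : UnitAddTorus (Fin n),
      ‖∑' d, UnitAddTorus.mFourier d t • (poissonWeight r d : ℂ) • c d‖ ≤ K) :
    ∀ᵐ t ∂(torusMeasure n), ‖fourierSeries n E c t‖ ≤ K := by
  let r : ℕ → ℝ := fun j => 1 - 1 / ((j : ℝ) + 1)
  have hr0 : ∀ j, 0 ≤ r j := fun j => by
    have : 1 / ((j : ℝ) + 1) ≤ 1 := (div_le_one (by positivity)).mpr (by simp)
    simp only [r]; linarith
  have hr1 : ∀ j, r j < 1 := fun j => by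
    have : 0 < 1 / ((j : ℝ) + 1) := by positivity
    simp only [r]; linarith
  have hr : Tendsto r atTop (𝓝 1) := by
    simpa [r] using (tendsto_one_div_add_atTop_nhds_zero_nat (𝕜 := ℝ)).const_sub 1
  let b : ℕ → lp (fun _ : Fin n → ℤ => E) 2 := fun j =>
    ⟨_, memlp_two_of_summable_norm (hs (r j) (hr0 j) (hr1 j))⟩
  -- Dominated convergence for sums, with majorant `‖c d‖ ^ 2`, because the weights lie in `[0, 1]`
  -- and tend to `1`.
  have hbc : Tendsto b atTop (𝓝 c) := by
    rw [tendsto_iff_norm_sub_tendsto_zero]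
    have hsq : ∀ j, ‖b j - c‖ ^ 2 = ∑' d, ‖b j d - c d‖ ^ 2 := fun j => by
      have := (lp.hasSum_norm (p := 2) (by norm_num) (b j - c)).tsum_eq
      simp only [ENNReal.toReal_ofNat, Real.rpow_ofNat] at this
      rw [← this]
      rfl
    have hcs : Summable fun d => ‖c d‖ ^ 2 := by
      simpa using (lp.hasSum_norm (p := 2) (by norm_num) c).summable
    have h0 : Tendsto (fun j => ‖b j - c‖ ^ 2) atTop (𝓝 0) := by
      simp_rw [hsq]
      have := tendsto_tsum_of_dominated_convergence (𝓕 := atTop)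
        (f := fun j d => ‖b j d - c d‖ ^ 2) (g := fun _ => (0 : ℝ)) hcs (fun d => ?_)
        (Eventually.of_forall fun j d => ?_)
      · simpa using this
      · have h2 : Tendsto (fun j => (poissonWeight (r j) d : ℂ) • c d - c d) atTop
            (𝓝 ((poissonWeight 1 d : ℂ) • c d - c d)) :=
          ((Complex.continuous_ofReal.tendsto _).comp
            (((continuous_poissonWeight d).tendsto 1).comp hr)).smul_const _ |>.sub_const _
        have h3 := h2.norm.pow 2
        rw [poissonWeight_one, Complex.ofReal_one, one_smul, sub_self, norm_zero,
          zero_pow two_ne_zero] at h3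
        exact h3
      · have h2 : b j d - c d = -((1 - poissonWeight (r j) d : ℝ) : ℂ) • c d := by
          change (poissonWeight (r j) d : ℂ) • c d - c d = _
          push_cast
          module
        rw [Real.norm_of_nonneg (by positivity), h2, neg_smul, norm_neg, norm_smul, mul_pow]
        refine mul_le_of_le_one_left (by positivity) (pow_le_one₀ (norm_nonneg _) ?_)
        rw [Complex.norm_real, Real.norm_of_nonneg
          (sub_nonneg.mpr (poissonWeight_le_one (hr0 j) (hr1 j).le d))]
        linarith [poissonWeight_nonneg (hr0 j) d]
    have h1 := (Real.continuous_sqrt.tendsto 0).comp h0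
    simpa [Function.comp_def, Real.sqrt_sq (norm_nonneg _)] using h1
  have hW : Tendsto (fun j => fourierSeries n E (b j)) atTop (𝓝 (fourierSeries n E c)) :=
    ((fourierSeries n E).continuous.tendsto c).comp hbc
  -- `L²` convergence yields an almost everywhere convergent subsequence, which carries the uniform
  -- bound to the limit.
  obtain ⟨ns, -, hns⟩ := (tendstoInMeasure_of_tendsto_Lp hW).exists_seq_tendsto_ae
  have hall : ∀ᵐ t ∂(torusMeasure n), ∀ j, ‖fourierSeries n E (b j) t‖ ≤ K := by
    refine ae_all_iff.mpr fun j => ?_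
    filter_upwards [fourierSeries_ae_eq (b j) (hs (r j) (hr0 j) (hr1 j))] with t ht
    rw [ht]
    exact hb _ (hr0 j) (hr1 j) t
  filter_upwards [hns, hall] with t h1 h2
  exact le_of_tendsto h1.norm (Eventually.of_forall fun j => h2 (ns j))

/-- A family of operators on `ℤⁿ` whose Poisson means are uniformly bounded is the family of Fourier
coefficients of an operator-valued `L^∞` function. -/
theorem exists_isLInfty_of_poisson_le (a : (Fin n → ℤ) → E →L[ℂ] E) {C : ℝ} (hC : 0 ≤ C)
    (hs : ∀ x, ∀ r : ℝ, 0 ≤ r → r < 1 → Summable fun d => ‖(poissonWeight r d : ℂ) • a d x‖)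
    (hb : ∀ x, ∀ r : ℝ, 0 ≤ r → r < 1 → ∀ t : UnitAddTorus (Fin n),
      ‖∑' d, UnitAddTorus.mFourier d t • (poissonWeight r d : ℂ) • a d x‖ ≤ C * ‖x‖) :
    ∃ Φ : UnitAddTorus (Fin n) → E →L[ℂ] E, IsLInfty Φ ∧ ∀ (d : Fin n → ℤ) (x y : E),
      ∫ t, UnitAddTorus.mFourier d t * inner ℂ (Φ t x) y ∂(torusMeasure n) =
        inner ℂ (a d x) y := by
  let c : E → lp (fun _ : Fin n → ℤ => E) 2 := fun x =>
    ⟨fun d => a d x, memlp_two_of_sum_le (sum_sq_le_of_poisson_le (hs x) (hb x))⟩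
  let φ : E →ₗ[ℂ] L2Torus n E :=
    { toFun := fun x => fourierSeries n E (c x)
      map_add' := fun x y => by
        rw [← map_add]
        congr 1
        exact lp.ext (funext fun d => map_add (a d) x y)
      map_smul' := fun z x => by
        rw [RingHom.id_apply, ← map_smul]
        congr 1
        exact lp.ext (funext fun d => map_smul (a d) z x) }
  obtain ⟨Φ, hΦ, hae⟩ := exists_isLInfty φ hC fun x =>
    fourierSeries_ae_le_of_poisson_le (c x) (hs x) (hb x)
  refine ⟨Φ, hΦ, fun d x y => ?_⟩
  -- The exponential sits on `y`, in the linear slot of the inner product; hence the frequency is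
  -- `d` and not `-d`.
  have h := fourierSeries_inner (c x) d y
  rw [L2.inner_def] at h
  refine Eq.trans (integral_congr_ae ?_) h
  filter_upwards [hae x, fourierMonomialLp_ae d y] with t h1 h2
  rw [h1, h2, inner_smul_right]
  rfl

open Classical in
/-- The matrix entries of a Toeplitz operator are Fourier coefficients of its symbol. -/
theorem toeplitz_single_inner {Φ : UnitAddTorus (Fin n) → E →L[ℂ] E} (hΦ : IsLInfty Φ)
    (j k : Fin n → ℕ) (x y : E) :
    inner ℂ (((ContinuousLinearMap.adjoint (boundary n E).toContinuousLinearMap) ∘L laurent Φ hΦ ∘L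
      (boundary n E).toContinuousLinearMap) (lp.single 2 k x) j) y =
      ∫ t, UnitAddTorus.mFourier (fun i => (j i : ℤ) - k i) t * inner ℂ (Φ t x) y
        ∂(torusMeasure n) := by
  rw [← lp.inner_single_right (G := fun _ : Fin n → ℕ => E) j, ContinuousLinearMap.comp_apply,
    ContinuousLinearMap.adjoint_inner_left, ContinuousLinearMap.comp_apply]
  have hbd : ∀ (k : Fin n → ℕ) (x : E), (boundary n E).toContinuousLinearMap (lp.single 2 k x) =
      trigMonomialLp k x := fun k x =>
    orthogonalFamily_trigMonomialLp.linearIsometry_apply_single x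
  rw [hbd, hbd, L2.inner_def]
  refine integral_congr_ae ?_
  filter_upwards [coeFn_laurent Φ hΦ (trigMonomialLp k x), trigMonomialLp_ae k x,
    trigMonomialLp_ae j y] with t h1 h2 h3
  rw [h1, h2, h3, map_smul, inner_smul_left, inner_smul_right, conj_mFourier, ← mul_assoc,
    ← UnitAddTorus.mFourier_add]
  congr 3
  funext i
  simp only [Pi.add_apply, Pi.neg_apply]
  ring

end Fourier

end PolydiscHardy

namespace PolydiscHardy

/-! ### The boundary series of `Γ Ψ^*` -/

section Products

variable {n : ℕ} {E F : Type*}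
  [NormedAddCommGroup E] [InnerProductSpace ℂ E] [CompleteSpace E]
  [NormedAddCommGroup F] [InnerProductSpace ℂ F] [CompleteSpace F]

/-- The positive part of a multi-index in `ℤⁿ`. -/
def posIdx (d : Fin n → ℤ) : Fin n → ℕ := fun i => (d i).toNat

/-- The negative part of a multi-index in `ℤⁿ`. -/
def negIdx (d : Fin n → ℤ) : Fin n → ℕ := fun i => (-d i).toNat

theorem posIdx_negIdx_injective :
    Function.Injective fun d : Fin n → ℤ => (posIdx d, negIdx d) := by
  intro d d' h
  obtain ⟨h1, h2⟩ := Prod.ext_iff.mp h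
  funext i
  have h3 := congrFun h1 i
  have h4 := congrFun h2 i
  simp only [posIdx, negIdx] at h3 h4
  omega

/-- Pairs with disjoint supports are the positive and negative parts of their difference. The
remaining pairs are those annihilated in `comp_adjoint_eq_zero`. -/
theorem exists_ne_zero_of_notMem_range {p : (Fin n → ℕ) × (Fin n → ℕ)}
    (hp : p ∉ Set.range fun d : Fin n → ℤ => (posIdx d, negIdx d)) :
    ∃ i, p.1 i ≠ 0 ∧ p.2 i ≠ 0 := by
  by_contra! hcon
  refine hp ⟨fun i => (p.1 i : ℤ) - p.2 i, Prod.ext (funext fun i => ?_) (funext fun i => ?_)⟩ <;>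
  · have := hcon i
    simp only [posIdx, negIdx]
    omega

/-- The phases combine through `d = d⁺ - d⁻` and the radii through `|d| = d⁺ + d⁻`, which is where
the Poisson weight comes from. -/
theorem monom_circlePt_mul_conj (r : ℝ) (t : UnitAddTorus (Fin n)) (d : Fin n → ℤ) :
    monom (circlePt r t) (posIdx d) * (starRingEnd ℂ) (monom (circlePt r t) (negIdx d)) =
      UnitAddTorus.mFourier d t * (poissonWeight r d : ℂ) := by
  have h1 : (starRingEnd ℂ) (monom (fun _ : Fin n => (r : ℂ)) (negIdx d)) =
      monom (fun _ => (r : ℂ)) (negIdx d) := by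
    simp [monom]
  have h2 : monom (fun _ : Fin n => (r : ℂ)) (posIdx d) * monom (fun _ => (r : ℂ)) (negIdx d) =
      (poissonWeight r d : ℂ) := by
    rw [← monom_add]
    simp only [monom, poissonWeight, Complex.ofReal_prod, Complex.ofReal_pow]
    refine Finset.prod_congr rfl fun i _ => ?_
    congr 1
    simp only [Pi.add_apply, posIdx, negIdx]
    omega
  have h3 : d = (fun i => ((posIdx d i : ℕ) : ℤ)) + -(fun i => ((negIdx d i : ℕ) : ℤ)) := by
    funext i
    simp only [Pi.add_apply, Pi.neg_apply, posIdx, negIdx]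
    omega
  rw [monom_circlePt, monom_circlePt, map_mul, h1, conj_mFourier, mul_mul_mul_comm, h2,
    ← UnitAddTorus.mFourier_add, ← h3]

theorem comp_adjoint_eq_zero {A B : (Fin n → ℕ) → F →L[ℂ] E}
    (h : ∀ (i : Fin n) (l m : Fin n → ℕ),
      A (l + Pi.single i 1) ∘L ContinuousLinearMap.adjoint (B (m + Pi.single i 1)) = 0)
    {l m : Fin n → ℕ} {i : Fin n} (hl : l i ≠ 0) (hm : m i ≠ 0) (x : E) :
    A l (ContinuousLinearMap.adjoint (B m) x) = 0 := by
  have hle : ∀ k : Fin n → ℕ, k i ≠ 0 → Pi.single i 1 ≤ k := fun k hk r => by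
    by_cases hr : r = i
    · rw [hr, Pi.single_eq_same]
      exact Nat.one_le_iff_ne_zero.mpr hk
    · rw [Pi.single_eq_of_ne hr]
      exact Nat.zero_le _
  have := h i (l - Pi.single i 1) (m - Pi.single i 1)
  rw [tsub_add_cancel_of_le (hle l hl), tsub_add_cancel_of_le (hle m hm)] at this
  exact congrArg (fun T : E →L[ℂ] E => T x) this

/-- The Fourier expansion of `Γ(ζ) Ψ(ζ)^*` on the torus of radius `r < 1`. -/
theorem hasSum_mul_adjoint {Γ Ψ : (Fin n → ℂ) → F →L[ℂ] E} {A B : (Fin n → ℕ) → F →L[ℂ] E}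
    (hA : HasTaylorCoeffs Γ A) (hB : HasTaylorCoeffs Ψ B)
    (h : ∀ (i : Fin n) (l m : Fin n → ℕ),
      A (l + Pi.single i 1) ∘L ContinuousLinearMap.adjoint (B (m + Pi.single i 1)) = 0)
    {r : ℝ} (h0 : 0 ≤ r) (h1 : r < 1) (t : UnitAddTorus (Fin n)) (x : E) :
    (Summable fun d => ‖UnitAddTorus.mFourier d t • (poissonWeight r d : ℂ) •
      A (posIdx d) (ContinuousLinearMap.adjoint (B (negIdx d)) x)‖) ∧
    HasSum (fun d => UnitAddTorus.mFourier d t • (poissonWeight r d : ℂ) •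
      A (posIdx d) (ContinuousLinearMap.adjoint (B (negIdx d)) x))
      (Γ (circlePt r t) (ContinuousLinearMap.adjoint (Ψ (circlePt r t)) x)) := by
  set z := circlePt r t with hz
  have hzm : z ∈ polydisc n := circlePt_mem h0 h1 t
  -- The absolutely convergent double series `∑ A_l B_m^* x z^l (conj z)^m`; the hypothesis leaves
  -- only its terms at `(d⁺, d⁻)`.
  let u : (Fin n → ℕ) × (Fin n → ℕ) → E := fun p =>
    (monom z p.1 • A p.1) (ContinuousLinearMap.adjoint (monom z p.2 • B p.2) x)
  have hBs : Summable fun m => ‖ContinuousLinearMap.adjoint (monom z m • B m) x‖ := by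
    refine ((hB.summable_norm hzm).mul_right ‖x‖).of_nonneg_of_le (fun _ => norm_nonneg _)
      fun m => ?_
    refine (ContinuousLinearMap.le_opNorm _ _).trans ?_
    rw [LinearIsometryEquiv.norm_map]
  have hBx : HasSum (fun m => ContinuousLinearMap.adjoint (monom z m • B m) x)
      (ContinuousLinearMap.adjoint (Ψ z) x) :=
    ((hB z hzm).map (ContinuousLinearMap.adjoint (𝕜 := ℂ) (E := F) (F := E))
      (LinearIsometryEquiv.continuous _)).mapL (ContinuousLinearMap.apply ℂ F x)
  have hun : Summable fun p => ‖u p‖ := by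
    refine Summable.of_nonneg_of_le (fun _ => norm_nonneg _) (fun p => ?_)
      ((hA.summable_norm hzm).mul_of_nonneg hBs (fun _ => norm_nonneg _) fun _ => norm_nonneg _)
    exact ContinuousLinearMap.le_opNorm _ _
  have hu : HasSum u (Γ z (ContinuousLinearMap.adjoint (Ψ z) x)) := by
    have h1 : ∀ l, HasSum (fun m => u (l, m))
        ((monom z l • A l) (ContinuousLinearMap.adjoint (Ψ z) x)) := fun l =>
      hBx.mapL (monom z l • A l)
    have h2 := (hA z hzm).mapL (ContinuousLinearMap.apply ℂ E (ContinuousLinearMap.adjoint (Ψ z) x))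
    have h3 := hun.of_norm.hasSum.prod_fiberwise h1
    have h4 := h3.unique h2
    rw [ContinuousLinearMap.apply_apply] at h4
    rw [← h4]
    exact hun.of_norm.hasSum
  have hzero : ∀ p ∉ Set.range fun d : Fin n → ℤ => (posIdx d, negIdx d), u p = 0 := by
    intro p hp
    obtain ⟨i, hl, hm⟩ := exists_ne_zero_of_notMem_range hp
    simp only [u, map_smulₛₗ, smul_apply, comp_adjoint_eq_zero h hl hm, smul_zero]
  have hud : (fun d => UnitAddTorus.mFourier d t • (poissonWeight r d : ℂ) •
      A (posIdx d) (ContinuousLinearMap.adjoint (B (negIdx d)) x)) =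
      u ∘ fun d => (posIdx d, negIdx d) := by
    funext d
    simp only [u, map_smulₛₗ, smul_apply, Function.comp_apply]
    rw [smul_smul, smul_smul, hz, ← monom_circlePt_mul_conj, mul_comm]
    rfl
  rw [hud]
  refine ⟨?_, (posIdx_negIdx_injective.hasSum_iff hzero).mpr hu⟩
  have := congrFun hud
  simp only [this]
  exact hun.comp_injective posIdx_negIdx_injective

theorem norm_mFourier_apply (d : Fin n → ℤ) (t : UnitAddTorus (Fin n)) :
    ‖UnitAddTorus.mFourier d t‖ = 1 := by
  simp only [UnitAddTorus.mFourier, ContinuousMap.coe_mk, norm_prod, fourier_apply,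
    Circle.norm_coe, Finset.prod_const_one]

/-- A Toeplitz operator has constant matrix entries along the diagonals. -/
theorem IsToeplitz.single_shift {T : HardySpace n E →L[ℂ] HardySpace n E} (hT : IsToeplitz T)
    (j k e : Fin n → ℕ) (x : E) :
    T (lp.single 2 (k + e) x) (j + e) = T (lp.single 2 k x) j := by
  obtain ⟨Φ, hΦ, rfl⟩ := hT
  refine ext_inner_right ℂ fun y => ?_
  rw [toeplitz_single_inner, toeplitz_single_inner]
  congr 1
  funext t
  congr 3
  funext i
  simp

end Products

end PolydiscHardy

/-! ### The Toeplitz criterion -/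

open PolydiscHardy
theorem proposition3p3 (n : ℕ) {F E : Type*}
    [NormedAddCommGroup F] [InnerProductSpace ℂ F] [CompleteSpace F]
    [NormedAddCommGroup E] [InnerProductSpace ℂ E] [CompleteSpace E]
    (Γ Ψ : (Fin n → ℂ) → F →L[ℂ] E) (hΓ : IsHInfty Γ) (hΨ : IsHInfty Ψ)
    (A B : (Fin n → ℕ) → F →L[ℂ] E)
    (hA : HasTaylorCoeffs Γ A) (hB : HasTaylorCoeffs Ψ B) :
    IsToeplitz (mulOp Γ ∘L ContinuousLinearMap.adjoint (mulOp Ψ)) ↔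
      ∀ (i : Fin n) (l m : Fin n → ℕ),
        A (l + Pi.single i 1) ∘L ContinuousLinearMap.adjoint (B (m + Pi.single i 1)) = 0 := by
  classical
  constructor
  · intro hT i
    refine eq_zero_of_shift_invariant (fun l m => A l ∘L ContinuousLinearMap.adjoint (B m)) i
      fun j k => ?_
    refine ContinuousLinearMap.ext fun x => ?_
    have h := hT.single_shift j k (Pi.single i 1) x
    rw [mulOp_adjoint_single_apply hΓ hΨ hA hB, mulOp_adjoint_single_apply hΓ hΨ hA hB] at h
    simpa only [sum_apply, ContinuousLinearMap.comp_apply] using h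
  · intro h
    obtain ⟨C, hC⟩ := hΓ.bounded
    obtain ⟨D, hD⟩ := hΨ.bounded
    have h0mem : (0 : Fin n → ℂ) ∈ polydisc n := fun i => by simp
    have hC0 : 0 ≤ C := (norm_nonneg _).trans (hC 0 h0mem)
    have hD0 : 0 ≤ D := (norm_nonneg _).trans (hD 0 h0mem)
    obtain ⟨Φ, hΦ, hcoeff⟩ := exists_isLInfty_of_poisson_le
      (fun d : Fin n → ℤ => A (posIdx d) ∘L ContinuousLinearMap.adjoint (B (negIdx d)))
      (mul_nonneg hC0 hD0)
      -- The exponentials have modulus one, so summability may be read off at the point `t = 0`.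
      (fun x r h0 h1 => by
        simpa only [norm_smul, norm_mFourier_apply, one_mul, ContinuousLinearMap.comp_apply] using
          (hasSum_mul_adjoint hA hB h h0 h1 0 x).1)
      (fun x r h0 h1 t => by
        have hz := circlePt_mem h0 h1 t
        have hsum := (hasSum_mul_adjoint hA hB h h0 h1 t x).2.tsum_eq
        simp only [ContinuousLinearMap.comp_apply]
        rw [hsum, mul_assoc]
        refine (Γ _).le_of_opNorm_le_of_le (hC _ hz) ?_
        refine ContinuousLinearMap.le_of_opNorm_le _ ?_ x
        rw [LinearIsometryEquiv.norm_map]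
        exact hD _ hz)
    refine ⟨Φ, hΦ, ext_single fun j k x => ext_inner_right ℂ fun y => ?_⟩
    -- Any `p ≤ j ⊓ k` other than `j ⊓ k` leaves `j - p` and `k - p` a common nonzero coordinate, so
    -- only `p = j ⊓ k` contributes, with `j - p` and `k - p` the positive and negative parts of `j
    -- - k`.
    rw [toeplitz_single_inner, hcoeff, mulOp_adjoint_single_apply hΓ hΨ hA hB,
      Finset.sum_eq_single (j ⊓ k)]
    · have h1 : j - j ⊓ k = posIdx fun i => (j i : ℤ) - k i := by
        funext i
        simp only [posIdx, Pi.sub_apply, Pi.inf_apply]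
        omega
      have h2 : k - j ⊓ k = negIdx fun i => (j i : ℤ) - k i := by
        funext i
        simp only [negIdx, Pi.sub_apply, Pi.inf_apply]
        omega
      rw [h1, h2, ContinuousLinearMap.comp_apply]
    · intro p hp hne
      have hle := Finset.mem_Iic.mp hp
      obtain ⟨i, hi⟩ : ∃ i, p i ≠ (j ⊓ k) i := by
        by_contra! hcon
        exact hne (funext hcon)
      have hi2 := (hle i).lt_of_ne hi
      obtain ⟨h1, h2⟩ := lt_inf_iff.mp hi2
      exact comp_adjoint_eq_zero h (i := i) (Nat.sub_ne_zero_of_lt h1)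
        (Nat.sub_ne_zero_of_lt h2) x
    · intro hcon
      exact absurd (Finset.mem_Iic.mpr le_rfl) hcon
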